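/- For $x\in\mathbb R$ let $\operatorname{sinc}x=\frac{\sin \pi x}{\pi x}$ if $x\neq0$ and $\operatorname{sinc}0=1$. For $\sigma>0$ and $1\le p\le\infty$ let the Bernstein space $B_\sigma^p$ be the set of all functions $f:\mathbb R\to\mathbb C$ in $L^p(\mathbb R)\cap C^\infty(\mathbb R)$ whose distributional Fourier transform $\mathcal F f$ is supported in $[-\sigma,\sigma]$; here $\langle \mathcal F f,\varphi\rangle=\int_{\mathbb R} f(x)\,\mathcal F\varphi(x)\,dx$ and $\mathcal F\varphi(\xi)=\frac1{\sqrt{2\pi}}\int_{\mathbb R}\varphi(x)e^{-ix\xi}\,dx$ for Schwartz functions $\varphi$. **Theorem.** Let $\sigma>0$, $1\le p<\infty$ and $f\in B_\sigma^p$. Then for every $x\in\mathbb R$ $$f(x)=\sum_{k\in\mathbb Z} f\!\left(\frac{k\pi}{\sigma}\right)\operatorname{sinc}\!\left(\frac{\sigma x}{\pi}-k\right),$$ and for every integer $m\ge0$ and every $x\in\mathbb R$ $$f^{(m)}(x)=\sum_{k\in\mathbb Z} f\!\left(\frac{k\pi}{\sigma}\right)\left(\frac{d}{dx}\right)^{m}\left[\operatorname{sinc}\!\left(\frac{\sigma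 x}{\pi}-k\right)\right].$$ Each of these series converges absolutely at every $x\in\mathbb R$, and uniformly on $\mathbb R$. -/

import Mathlib

open scoped ENNReal ContDiff FourierTransform SchwartzMap

noncomputable section

/-- The normalised cardinal sine: `sin (π x) / (π x)` for `x ≠ 0`, and `1` at `x = 0`. -/
def normSinc (x : ℝ) : ℝ := Real.sinc (Real.pi * x)

/-- The Bernstein space `B_σ^p`, `1 ≤ p ≤ ∞`: the smooth functions `f : ℝ → ℂ` in `L^p(ℝ)` whose
distributional Fourier transform `φ ↦ ∫ f(x) (ℱφ)(x) dx` is supported in `[-σ, σ]`, where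
`ℱφ(ξ) = (2π)^{-1/2} ∫ φ(x) exp(-i x ξ) dx`.

Mathlib's transform `𝓕` of tempered distributions has the kernel `exp(-2π i x ξ)`; its frequency
variable is the angular frequency divided by `2π`, so that the band `[-σ, σ]` reads
`[-σ/(2π), σ/(2π)]`. -/
structure IsBernstein (σ : ℝ) (p : ℝ≥0∞) [Fact (1 ≤ p)] (f : ℝ → ℂ) : Prop where
  contDiff : ContDiff ℝ ∞ f
  memLp : MeasureTheory.MemLp f p
  dsupport_subset :
    Distribution.dsupport
        (𝓕 (MeasureTheory.Lp.toTemperedDistribution (memLp.toLp f)) : 𝓢'(ℝ, ℂ)) ⊆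
      Set.Icc (-(σ / (2 * Real.pi))) (σ / (2 * Real.pi))

/-- The Bernstein space `B_σ^p` as a set of functions. -/
def bernsteinSpace (σ : ℝ) (p : ℝ≥0∞) [Fact (1 ≤ p)] : Set (ℝ → ℂ) :=
  {f | IsBernstein σ p f}

/-- The series `∑_k u_k` of functions on `ℝ`, indexed by `k ∈ ℤ`, has the sum `g` at every point,
converges absolutely at every point, and its finite partial sums converge to `g` uniformly
on `ℝ`. -/
def SumsAbsolutelyUniformly (u : ℤ → ℝ → ℂ) (g : ℝ → ℂ) : Prop :=
  (∀ x, HasSum (fun k ↦ u k x) (g x)) ∧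
  (∀ x, Summable fun k ↦ ‖u k x‖) ∧
  TendstoUniformly (fun (s : Finset ℤ) (x : ℝ) ↦ ∑ k ∈ s, u k x) g Filter.atTop

end

/-! If `f` is integrable, its transform vanishes outside an open band of length `T`, and its samples
are absolutely summable, the theorem is the Fourier series of that transform: the coefficients are
samples of `f`, and inversion turns each exponential into a `sinc`
(`hasSum_sinc_of_fourier_eq_zero`).

A general `f` is multiplied by `η (c y)`, where `η` is the transform of a bump and `η 0 = 1`. This
gives integrability and widens the band by O(c) (`IsBernstein.fourier_mul_eq_zero`). Sampling at a
slightly higher rate, one lets c → 0. The interchange with the sum rests on Hölder and a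
Plancherel–Pólya bound on the samples, uniform in the step (`exists_tsum_norm_rpow_le`); that bound
comes from reproducing `f` by a Schwartz kernel (`exists_schwartz_reproducing`).

Each derivative of `sinc` is O(1/(1+|x|)), so its translates are uniformly bounded in ℓ^q for every
q > 1. Hölder then makes all derived series converge uniformly, and termwise differentiation is
allowed. -/

open MeasureTheory Filter Topology Set

/-! ### Supports of distributions and band limits -/

@[simp]
theorem HasCompactSupport.coe_toSchwartzMap {f : ℝ → ℂ} (h₁ : HasCompactSupport f)
    (h₂ : ContDiff ℝ ∞ f) : ⇑(h₁.toSchwartzMap h₂) = f := rfl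

/-- A tempered distribution on `ℝ` annihilates every compactly supported test function whose
support is disjoint from the support of the distribution. -/
theorem TemperedDistribution.apply_eq_zero_of_disjoint_dsupport (T : 𝓢'(ℝ, ℂ)) (ψ : 𝓢(ℝ, ℂ))
    (hc : HasCompactSupport ψ) (hd : Disjoint (tsupport ψ) (Distribution.dsupport T)) :
    T ψ = 0 := by
  classical
  have hx : ∀ x ∈ tsupport ψ, ∃ s : Set ℝ, Distribution.IsVanishingOn T s ∧ IsOpen s ∧ x ∈ s :=
    fun x hx ↦ (Distribution.notMem_dsupport_iff x).1 (Set.disjoint_left.1 hd hx)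
  choose! s hs1 hs2 hs3 using hx
  obtain ⟨t, ht, hcov⟩ := hc.isCompact.elim_nhds_subcover s
    fun x hx ↦ (hs2 x hx).mem_nhds (hs3 x hx)
  -- The distribution is known to vanish only locally; a partition of unity cuts `ψ` into pieces,
  -- each inside one vanishing set.
  obtain ⟨ρ, hρ⟩ := SmoothPartitionOfUnity.exists_isSubordinate (modelWithCornersSelf ℝ ℝ)
    (isClosed_tsupport ψ) (fun i : t ↦ s i) (fun i ↦ hs2 i (ht i i.2))
    (by simpa [Set.iUnion_subtype] using hcov)
  have hsm : ∀ i, ContDiff ℝ ∞ (fun x ↦ ((ρ i x : ℝ) : ℂ) * ψ x) := fun i ↦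
    (Complex.ofRealCLM.contDiff.comp (ρ i).contMDiff.contDiff).mul ψ.smooth'
  have hcs : ∀ i, HasCompactSupport (fun x ↦ ((ρ i x : ℝ) : ℂ) * ψ x) := fun i ↦ hc.mul_left
  have hsum : ψ = ∑ i, (hcs i).toSchwartzMap (hsm i) := by
    ext x
    rw [_root_.sum_apply]
    simp only [HasCompactSupport.coe_toSchwartzMap]
    rw [← Finset.sum_mul]
    by_cases h : x ∈ tsupport ψ
    · have := ρ.sum_eq_one h
      rw [finsum_eq_sum_of_fintype] at this
      rw [← Complex.ofReal_sum, this]; simp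
    · simp [image_eq_zero_of_notMem_tsupport h]
  rw [hsum, map_sum]
  refine Finset.sum_eq_zero fun i _ ↦ hs1 i (ht i i.2) _ ?_
  refine subset_trans ?_ (hρ i)
  rw [HasCompactSupport.coe_toSchwartzMap]
  refine closure_mono fun x hx ↦ ?_
  simp only [Function.mem_support] at hx ⊢
  intro h; apply hx; simp [h]

/-- The Fourier transform of a dilated and translated function. -/
theorem fourier_comp_affine (B : ℝ → ℂ) {c : ℝ} (hc : 0 < c) (w y : ℝ) :
    𝓕 (fun t ↦ (c⁻¹ : ℂ) * B ((t - w) / c)) y =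
      𝓕 B (c * y) * Complex.exp (-2 * Real.pi * Complex.I * y * w) := by
  simp only [Real.fourier_real_eq_integral_exp_smul, smul_eq_mul]
  have h1 := integral_sub_right_eq_self (μ := volume) (fun t : ℝ ↦
    Complex.exp (↑(-2 * Real.pi * (t + w) * y) * Complex.I) * ((c⁻¹ : ℂ) * B (t / c))) w
  simp only [sub_add_cancel] at h1
  rw [h1]
  have h2 := Measure.integral_comp_div (fun s : ℝ ↦
    Complex.exp (↑(-2 * Real.pi * (c * s + w) * y) * Complex.I) * ((c⁻¹ : ℂ) * B s)) c
  have h3 : ∀ t : ℝ, c * (t / c) = t := fun t ↦ by field_simp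
  simp only [h3] at h2
  rw [h2, abs_of_pos hc, ← integral_smul, ← integral_mul_const]
  congr 1
  ext s
  have hc' : (c : ℂ) ≠ 0 := by exact_mod_cast hc.ne'
  rw [Complex.real_smul, mul_left_comm, mul_inv_cancel_left₀ hc', mul_right_comm _ (B s) (Complex.exp _),
    ← Complex.exp_add]
  congr 2
  push_cast
  ring

/-- For `f` in a Bernstein space and `B` smooth and supported in `[-δ, δ]`, the product of `f`
with a dilate of `𝓕 B` has its Fourier transform supported in a slightly larger band. -/
theorem IsBernstein.fourier_mul_eq_zero {σ : ℝ} {p : ℝ≥0∞} [Fact (1 ≤ p)] {f : ℝ → ℂ}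
    (hf : IsBernstein σ p f) {B : ℝ → ℂ} (hB : ContDiff ℝ ∞ B) {δ : ℝ}
    (hBs : Function.support B ⊆ Icc (-δ) δ) {c : ℝ} (hc : 0 < c) {w : ℝ}
    (hw : σ / (2 * Real.pi) + c * δ < |w|) :
    𝓕 (fun y ↦ f y * 𝓕 B (c * y)) w = 0 := by
  have hsub : tsupport (fun t ↦ (c⁻¹ : ℂ) * B ((t - w) / c)) ⊆ Icc (w - c * δ) (w + c * δ) := by
    refine closure_minimal (fun t ht ↦ ?_) isClosed_Icc
    have : (t - w) / c ∈ Icc (-δ) δ := hBs fun h ↦ ht (by simp [h])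
    rw [mem_Icc, le_div_iff₀ hc, div_le_iff₀ hc] at this
    constructor <;> linarith [this.1, this.2]
  have hcs : HasCompactSupport (fun t ↦ (c⁻¹ : ℂ) * B ((t - w) / c)) :=
    isCompact_Icc.of_isClosed_subset (isClosed_tsupport _) hsub
  have hsm : ContDiff ℝ ∞ (fun t ↦ (c⁻¹ : ℂ) * B ((t - w) / c)) := by
    refine contDiff_const.mul (hB.comp ?_)
    fun_prop
  -- Pairing the transform of `f` with this bump around `w` gives exactly the value at `w` of the
  -- transform of the product.
  have h0 := TemperedDistribution.apply_eq_zero_of_disjoint_dsupport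
    (𝓕 (MeasureTheory.Lp.toTemperedDistribution (hf.memLp.toLp f)) : 𝓢'(ℝ, ℂ))
    (hcs.toSchwartzMap hsm) hcs (by
      refine Disjoint.mono hsub hf.dsupport_subset ?_
      rw [Set.disjoint_left]
      intro t ht ht'
      rcases abs_cases w with h | h <;> linarith [ht.1, ht.2, ht'.1, ht'.2])
  rw [TemperedDistribution.fourier_apply, Lp.toTemperedDistribution_apply] at h0
  rw [Real.fourier_real_eq_integral_exp_smul, ← h0]
  refine integral_congr_ae ?_
  filter_upwards [hf.memLp.coeFn_toLp] with y hy
  rw [hy, SchwartzMap.fourier_coe, HasCompactSupport.coe_toSchwartzMap, fourier_comp_affine B hc]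
  simp only [smul_eq_mul]
  push_cast
  ring_nf

/-! ### Decay of the derivatives of sinc, and lattice sums -/

/-- The singularity of sin z / z at 0 is removable, so `sinc` is the restriction of an entire
function. -/
theorem Real.contDiff_sinc : ContDiff ℝ ∞ Real.sinc := by
  have h1 : Differentiable ℂ (dslope Complex.sin 0) := by
    rw [← differentiableOn_univ, Complex.differentiableOn_dslope univ_mem]
    exact Complex.differentiable_sin.differentiableOn
  have h2 : ContDiff ℝ ∞ (dslope Complex.sin 0) := (h1.contDiff (n := ∞)).restrict_scalars ℝ
  have h3 : Real.sinc = fun x : ℝ ↦ Complex.reCLM (dslope Complex.sin 0 (Complex.ofRealCLM x)) := by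
    ext x
    rcases eq_or_ne x 0 with rfl | hx
    · simp
    · rw [Real.sinc_of_ne_zero hx, dslope_of_ne _ (by simpa using hx), slope_def_field]
      simp only [Complex.ofRealCLM_apply, Complex.sin_zero, sub_zero, Complex.reCLM_apply]
      rw [← Complex.ofReal_sin, ← Complex.ofReal_div, Complex.ofReal_re]
  rw [h3]
  fun_prop

theorem Real.mul_sinc (x : ℝ) : x * Real.sinc x = Real.sin x := by
  rcases eq_or_ne x 0 with rfl | hx
  · simp
  · rw [Real.sinc_of_ne_zero hx]; field_simp

theorem Real.hasDerivAt_iteratedDeriv_sinc (m : ℕ) (x : ℝ) :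
    HasDerivAt (iteratedDeriv m Real.sinc) (iteratedDeriv (m + 1) Real.sinc x) x := by
  rw [iteratedDeriv_succ]
  exact ((Real.contDiff_sinc.differentiable_iteratedDeriv m (mod_cast ENat.natCast_lt_top m)) x).hasDerivAt

/-- Leibniz' rule for x sinc x = sin x. At `m = 0` the truncated index `m - 1` is harmless, its
coefficient being 0. -/
theorem Real.iteratedDeriv_sin_eq_mul_sinc (m : ℕ) :
    iteratedDeriv m Real.sin = fun x ↦ x * iteratedDeriv m Real.sinc x +
      m * iteratedDeriv (m - 1) Real.sinc x := by
  induction m with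
  | zero => ext x; simp [Real.mul_sinc]
  | succ m ih =>
    ext x
    rw [iteratedDeriv_succ, ih]
    have h1 := (hasDerivAt_id x).mul (Real.hasDerivAt_iteratedDeriv_sinc m x)
    have h2 : HasDerivAt (fun x ↦ (m : ℝ) * iteratedDeriv (m - 1) Real.sinc x)
        (m * iteratedDeriv m Real.sinc x) x := by
      rcases m with _ | m
      · simpa using hasDerivAt_const x (0 : ℝ)
      · exact (Real.hasDerivAt_iteratedDeriv_sinc m x).const_mul _
    refine ((h1.add h2).deriv).trans ?_
    simp
    ring

theorem Real.exists_abs_iteratedDeriv_sinc_le (m : ℕ) :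
    ∃ C, 0 ≤ C ∧ ∀ x, |iteratedDeriv m Real.sinc x| ≤ C / (1 + |x|) := by
  induction m with
  | zero =>
    refine ⟨2, by norm_num, fun x ↦ ?_⟩
    rw [le_div_iff₀ (by positivity), iteratedDeriv_zero, mul_add, mul_one, ← abs_mul, mul_comm _ x,
      Real.mul_sinc]
    linarith [Real.abs_sinc_le_one x, Real.abs_sin_le_one x]
  | succ m ih =>
    obtain ⟨C, hC, h⟩ := ih
    have hcont : Continuous (iteratedDeriv (m + 1) Real.sinc) :=
      Real.contDiff_sinc.continuous_iteratedDeriv (m + 1) (mod_cast le_top)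
    obtain ⟨D, hD⟩ := (isCompact_Icc (a := (-1 : ℝ)) (b := 1)).exists_bound_of_continuousOn
      hcont.continuousOn
    have hD0 : 0 ≤ D := (norm_nonneg _).trans (hD 0 (by simp))
    -- Compactness gives `D` on |x| ≤ 1; for |x| ≥ 1 the Leibniz identity bounds x sinc^(m+1) by 1 +
    -- (m+1)C. In both ranges 1 + |x| ≤ 2 max(1, |x|) accounts for the factor 2.
    refine ⟨2 * (D + (1 + (m + 1) * C)), by positivity, fun x ↦ ?_⟩
    rw [le_div_iff₀ (by positivity)]
    have hK : 0 ≤ 1 + (m + 1) * C := by positivity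
    rcases le_total |x| 1 with hx | hx
    · have h1 := hD x (abs_le.1 hx)
      rw [Real.norm_eq_abs] at h1
      nlinarith [abs_nonneg x, abs_nonneg (iteratedDeriv (m + 1) Real.sinc x)]
    · have h1 := congrFun (Real.iteratedDeriv_sin_eq_mul_sinc (m + 1)) x
      simp only [Nat.add_sub_cancel, Nat.cast_add, Nat.cast_one] at h1
      have h2 : |x| * |iteratedDeriv (m + 1) Real.sinc x| ≤ 1 + (m + 1) * C := by
        rw [← abs_mul, eq_sub_of_add_eq h1.symm]
        refine (abs_sub _ _).trans (add_le_add (Real.abs_iteratedDeriv_sin_le_one _ _) ?_)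
        rw [abs_mul, abs_of_nonneg (by positivity : (0 : ℝ) ≤ m + 1)]
        gcongr
        exact (h x).trans (div_le_self hC (by linarith [abs_nonneg x]))
      nlinarith [abs_nonneg x, abs_nonneg (iteratedDeriv (m + 1) Real.sinc x)]

/-- The sums over `ℤ` of translates of `(1 + |·|) ^ (-q)` are bounded uniformly. -/
theorem Real.exists_tsum_one_add_abs_sub_rpow_le {q : ℝ} (hq : 1 < q) :
    ∃ C, ∀ u : ℝ, Summable (fun k : ℤ ↦ (1 + |u - k|) ^ (-q)) ∧
      ∑' k : ℤ, (1 + |u - k|) ^ (-q) ≤ C := by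
  have hS : Summable (fun k : ℤ ↦ (2 : ℝ) ^ q * (1 + |(k : ℝ)|) ^ (-q)) := by
    refine Summable.mul_left _ ?_
    have h1 : Summable (fun k : ℤ ↦ |(k : ℝ)| ^ (-q)) := Real.summable_abs_int_rpow hq
    refine Summable.of_norm_bounded_eventually (g := fun k : ℤ ↦ |(k : ℝ)| ^ (-q)) h1 ?_
    filter_upwards [(Set.finite_singleton (0 : ℤ)).compl_mem_cofinite] with k hk
    have hk' : (0 : ℝ) < |(k : ℝ)| := abs_pos.2 (by exact_mod_cast hk)
    rw [Real.norm_of_nonneg (by positivity)]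
    exact Real.rpow_le_rpow_of_nonpos hk' (by linarith) (by linarith)
  refine ⟨∑' k : ℤ, (2 : ℝ) ^ q * (1 + |(k : ℝ)|) ^ (-q), fun u ↦ ?_⟩
  -- An integer shift of the index reduces `u` to its fractional part, which moves |k| by less than
  -- 1.
  have hle : ∀ k : ℤ, (1 + |Int.fract u - k|) ^ (-q) ≤ (2 : ℝ) ^ q * (1 + |(k : ℝ)|) ^ (-q) := by
    intro k
    have h0 : (0 : ℝ) < 1 + |(k : ℝ)| := by positivity
    have h1 : (1 + |(k : ℝ)|) / 2 ≤ 1 + |Int.fract u - k| := by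
      have := abs_sub_abs_le_abs_sub (k : ℝ) (Int.fract u)
      rw [abs_sub_comm, abs_of_nonneg (Int.fract_nonneg u)] at this
      linarith [Int.fract_lt_one u, abs_nonneg (Int.fract u - k)]
    refine (Real.rpow_le_rpow_of_nonpos (by positivity) h1 (by linarith)).trans_eq ?_
    rw [Real.div_rpow h0.le (by norm_num), Real.rpow_neg (by norm_num : (0 : ℝ) ≤ 2)]
    field_simp
  have hsum : Summable (fun k : ℤ ↦ (1 + |Int.fract u - k|) ^ (-q)) :=
    Summable.of_nonneg_of_le (fun k ↦ by positivity) hle hS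
  have hshift : (fun k : ℤ ↦ (1 + |u - k|) ^ (-q)) =
      (fun k : ℤ ↦ (1 + |Int.fract u - k|) ^ (-q)) ∘ (Equiv.subRight ⌊u⌋) := by
    ext k
    simp only [Function.comp_apply, Equiv.subRight_apply, Int.cast_sub, Int.fract]
    ring_nf
  rw [hshift]
  refine ⟨(Equiv.subRight ⌊u⌋).summable_iff.2 hsum, ?_⟩
  refine ((Equiv.subRight ⌊u⌋).tsum_eq
    (fun k : ℤ ↦ (1 + |Int.fract u - k|) ^ (-q))).trans_le ?_
  exact Summable.tsum_le_tsum hle hsum hS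

/-! ### Uniform convergence from Hölder's inequality -/

/-- By Hölder's inequality a series `∑ a k * b i k`, with `a ∈ ℓ^r` and the sequences `b i` bounded
in the dual `ℓ^q`, converges absolutely and uniformly in `i`. -/
theorem tendstoUniformly_sum_mul_of_rpow {ι κ : Type*} {r q : ℝ} (hrq : r.HolderConjugate q)
    {a : κ → ℂ} {b : ι → κ → ℂ} {C : ℝ} (ha : Summable fun k ↦ ‖a k‖ ^ r)
    (hb : ∀ i, Summable fun k ↦ ‖b i k‖ ^ q) (hC : ∀ i, ∑' k, ‖b i k‖ ^ q ≤ C) :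
    (∀ i, Summable fun k ↦ ‖a k * b i k‖) ∧
    TendstoUniformly (fun (s : Finset κ) i ↦ ∑ k ∈ s, a k * b i k) (fun i ↦ ∑' k, a k * b i k)
      atTop := by
  have hs : ∀ i, Summable fun k ↦ ‖a k * b i k‖ := fun i ↦ by
    simpa only [norm_mul] using (Real.summable_and_inner_le_Lp_mul_Lq_tsum_of_nonneg hrq
      (fun k ↦ norm_nonneg _) (fun k ↦ norm_nonneg _) ha (hb i)).1
  refine ⟨hs, ?_⟩
  rw [Metric.tendstoUniformly_iff]
  intro ε hε
  -- Only the tail of `a` has to be small; the other Hölder factor is bounded by `C` uniformly in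
  -- `i`.
  have hlim : Tendsto (fun s : Finset κ ↦ (∑' k : { k // k ∉ s }, ‖a k‖ ^ r) ^ (1 / r) * C ^ (1 / q))
      atTop (𝓝 0) := by
    have h1 := ((tendsto_tsum_compl_atTop_zero fun k ↦ ‖a k‖ ^ r).rpow_const
      (p := 1 / r) (Or.inr (by have := hrq.pos; positivity))).mul_const (C ^ (1 / q))
    rwa [Real.zero_rpow (by have := hrq.pos; positivity), zero_mul] at h1
  filter_upwards [hlim.eventually (gt_mem_nhds hε)] with s hs' i
  have hsub : Summable fun k : { k // k ∉ s } ↦ ‖a k * b i k‖ := (hs i).subtype {k | k ∉ s}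
  refine lt_of_le_of_lt ?_ hs'
  rw [dist_eq_norm, ← (hs i).of_norm.sum_add_tsum_subtype_compl s, add_sub_cancel_left]
  refine (norm_tsum_le_tsum_norm hsub).trans ?_
  simp only [norm_mul]
  refine ((Real.summable_and_inner_le_Lp_mul_Lq_tsum_of_nonneg hrq
      (fun k ↦ norm_nonneg _) (fun k ↦ norm_nonneg _) (ha.subtype {k | k ∉ s})
      ((hb i).subtype {k | k ∉ s})).2).trans ?_
  have hq := hrq.symm.pos
  refine mul_le_mul_of_nonneg_left (Real.rpow_le_rpow (tsum_nonneg fun k ↦ by positivity) ?_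
    (by positivity)) (Real.rpow_nonneg (tsum_nonneg fun k ↦ by positivity) _)
  exact ((hb i).tsum_subtype_le _ {k | k ∉ s} fun k ↦ by positivity).trans (hC i)

/-! ### Sampling of integrable band-limited functions -/

theorem MeasureTheory.Integrable.continuous_fourier {g : ℝ → ℂ} (hg : Integrable g) :
    Continuous (𝓕 g) :=
  VectorFourier.fourierIntegral_continuous Real.continuous_fourierChar
    (by exact continuous_inner) hg

theorem MeasureTheory.Integrable.integrable_fourier_of_eq_zero {g : ℝ → ℂ} (hg : Integrable g)
    {R : ℝ} (hR : ∀ ξ, R < |ξ| → 𝓕 g ξ = 0) : Integrable (𝓕 g) := by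
  refine hg.continuous_fourier.integrable_of_hasCompactSupport ?_
  refine HasCompactSupport.of_support_subset_isCompact (isCompact_Icc (a := -R) (b := R))
    fun ξ hξ ↦ abs_le.1 ?_
  by_contra h
  exact hξ (hR ξ (not_le.1 h))

theorem intervalIntegral_exp_eq_sinc {T : ℝ} (hT : 0 < T) (y : ℝ) :
    ∫ ξ in (-T / 2)..(T / 2), Complex.exp (2 * Real.pi * Complex.I * y * ξ) =
      T * (Real.sinc (Real.pi * (T * y)) : ℝ) := by
  rcases eq_or_ne y 0 with rfl | hy
  · simp only [Complex.ofReal_zero, mul_zero, zero_mul, Complex.exp_zero,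
      intervalIntegral.integral_const, Real.sinc_zero, Complex.ofReal_one]
    simp only [Complex.real_smul]
    push_cast
    ring
  · have hy' : (y : ℂ) ≠ 0 := by exact_mod_cast hy
    have hT' : (T : ℂ) ≠ 0 := by exact_mod_cast hT.ne'
    have hpi : (Real.pi : ℂ) ≠ 0 := by exact_mod_cast Real.pi_ne_zero
    have hc : 2 * Real.pi * Complex.I * y ≠ 0 := by
      simp [hy', hpi]
    rw [integral_exp_mul_complex hc, Real.sinc_of_ne_zero (by positivity)]
    push_cast
    rw [Complex.sin, div_eq_iff hc]
    field_simp
    rw [Complex.I_sq]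
    ring_nf

/-- The sampling theorem for continuous integrable functions whose Fourier transform vanishes
outside the open band `(-T/2, T/2)` and whose samples are absolutely summable. -/
theorem hasSum_sinc_of_fourier_eq_zero {T : ℝ} (hT : 0 < T) {g : ℝ → ℂ} (hgc : Continuous g)
    (hg : Integrable g) (hband : ∀ ξ, T / 2 ≤ |ξ| → 𝓕 g ξ = 0)
    (hs : Summable fun k : ℤ ↦ ‖g (k / T)‖) (x : ℝ) :
    HasSum (fun k : ℤ ↦ g (k / T) * (Real.sinc (Real.pi * (T * x - k)) : ℝ)) (g x) := by
  have hTf : Fact (0 < T) := ⟨hT⟩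
  have hT' : (T : ℂ) ≠ 0 := by exact_mod_cast hT.ne'
  have hGc := hg.continuous_fourier
  have hGi := hg.integrable_fourier_of_eq_zero (R := T / 2) fun ξ hξ ↦ hband ξ hξ.le
  have hinv : ∀ y, g y = ∫ ξ in (-T / 2)..(T / 2),
      Complex.exp (2 * Real.pi * Complex.I * y * ξ) * 𝓕 g ξ := by
    intro y
    rw [← hg.fourierInv_fourier_eq hGi hgc.continuousAt, Real.fourierInv_eq',
      intervalIntegral.integral_of_le (by linarith),
      setIntegral_eq_integral_of_forall_compl_eq_zero]
    · congr 1
      ext ξ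
      simp only [RCLike.inner_apply, conj_trivial, smul_eq_mul]
      push_cast
      ring_nf
    · intro ξ hξ
      rw [hband, mul_zero]
      by_contra h
      rw [not_le, abs_lt] at h
      exact hξ ⟨by linarith, by linarith⟩
  have hend : -T / 2 + T = T / 2 := by ring
  -- The transform vanishes at both ends of the band, so its periodic extension is continuous.
  have hlift : Continuous (AddCircle.liftIco T (-T / 2) (𝓕 g)) := by
    refine AddCircle.liftIco_continuous ?_ hGc.continuousOn
    rw [hend, hband _ (le_abs_self _), hband _ (by rw [neg_div, abs_neg]; exact le_abs_self _)]
  have hcoeff : ∀ n : ℤ, fourierCoeff (AddCircle.liftIco T (-T / 2) (𝓕 g)) n =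
      (T : ℂ)⁻¹ * g ((-n : ℤ) / T) := by
    intro n
    rw [fourierCoeff_liftIco_eq, fourierCoeffOn_eq_integral, hinv]
    rw [← intervalIntegral.integral_const_mul, hend, ← intervalIntegral.integral_smul]
    congr 1
    ext ξ
    simp only [fourier_coe_apply, Complex.real_smul, smul_eq_mul]
    push_cast
    rw [show (T : ℂ) / 2 - -T / 2 = T by ring, one_div]
    ring_nf
  have hs' : Summable fun n : ℤ ↦ ‖g ((-n : ℤ) / T)‖ := (Equiv.neg ℤ).summable_iff.2 hs
  have hser : ∀ ξ ∈ Ico (-T / 2) (T / 2), HasSum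
      (fun n : ℤ ↦ (T : ℂ)⁻¹ * g ((-n : ℤ) / T) *
        Complex.exp (2 * Real.pi * Complex.I * n * ξ / T)) (𝓕 g ξ) := by
    intro ξ hξ
    have h1 := has_pointwise_sum_fourier_series_of_summable (T := T)
      (f := ⟨AddCircle.liftIco T (-T / 2) (𝓕 g), hlift⟩) (by
        simp only [ContinuousMap.coe_mk]
        rw [funext hcoeff]
        refine Summable.mul_left _ hs'.of_norm) (ξ : AddCircle T)
    simp only [ContinuousMap.coe_mk, hcoeff, fourier_coe_apply, smul_eq_mul] at h1
    rwa [AddCircle.liftIco_coe_apply (by rwa [hend])] at h1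
  have hint : HasSum (fun n : ℤ ↦ ∫ ξ in (-T / 2)..(T / 2),
      Complex.exp (2 * Real.pi * Complex.I * x * ξ) * ((T : ℂ)⁻¹ * g ((-n : ℤ) / T) *
        Complex.exp (2 * Real.pi * Complex.I * n * ξ / T))) (g x) := by
    rw [hinv x]
    have hexp : ∀ a : ℝ, ‖Complex.exp (a * Complex.I)‖ = 1 := Complex.norm_exp_ofReal_mul_I
    refine intervalIntegral.hasSum_integral_of_dominated_convergence
      (fun n _ ↦ T⁻¹ * ‖g ((-n : ℤ) / T)‖) (fun n ↦ ?_) (fun n ↦ ?_) ?_ ?_ ?_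
    · exact Continuous.aestronglyMeasurable (by fun_prop)
    · refine ae_of_all _ fun ξ _ ↦ le_of_eq ?_
      rw [norm_mul, norm_mul, norm_mul,
        show (2 * Real.pi * Complex.I * x * ξ : ℂ) = ((2 * Real.pi * x * ξ : ℝ) : ℂ) * Complex.I by
          push_cast; ring,
        show (2 * Real.pi * Complex.I * n * ξ / T : ℂ) =
          ((2 * Real.pi * n * ξ / T : ℝ) : ℂ) * Complex.I by push_cast; ring, hexp, hexp,
        norm_inv, Complex.norm_real, Real.norm_of_nonneg hT.le]
      ring
    · exact ae_of_all _ fun _ _ ↦ hs'.mul_left _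
    · exact _root_.intervalIntegrable_const
    -- The series is known on `Ico`, the integral runs over `Ioc`: the endpoint is discarded as a
    -- null set.
    · have h0 : ∀ᵐ ξ : ℝ, ξ ≠ T / 2 := Measure.ae_ne _ _
      filter_upwards [h0] with ξ hne hξ
      rw [uIoc_of_le (by linarith)] at hξ
      exact (hser ξ ⟨hξ.1.le, lt_of_le_of_ne hξ.2 hne⟩).mul_left _
  rw [← (Equiv.neg ℤ).hasSum_iff]
  convert hint using 2 with n
  simp only [Function.comp_apply, Equiv.neg_apply]
  have h2 := intervalIntegral_exp_eq_sinc hT (x + n / T)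
  rw [show T * (x + n / T) = T * x - (-n : ℤ) by push_cast; field_simp; ring] at h2
  have h3 : ∀ ξ : ℝ, Complex.exp (2 * Real.pi * Complex.I * x * ξ) * ((T : ℂ)⁻¹ * g ((-n : ℤ) / T) *
        Complex.exp (2 * Real.pi * Complex.I * n * ξ / T)) = ((T : ℂ)⁻¹ * g ((-n : ℤ) / T)) *
        Complex.exp (2 * Real.pi * Complex.I * (x + n / T : ℝ) * ξ) := by
    intro ξ
    rw [mul_left_comm, ← Complex.exp_add]
    push_cast
    ring_nf
  simp_rw [h3]
  rw [intervalIntegral.integral_const_mul, h2]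
  field_simp

/-! ### Reproducing kernel and Plancherel–Pólya inequality -/

theorem SchwartzMap.exists_eq_comp_mul (η : 𝓢(ℝ, ℂ)) {c : ℝ} (hc : c ≠ 0) :
    ∃ ψ : 𝓢(ℝ, ℂ), ∀ y, ψ y = η (c * y) :=
  ⟨SchwartzMap.compCLMOfContinuousLinearEquiv ℂ
    (ContinuousLinearEquiv.unitsEquivAut ℝ (Units.mk0 c hc)) η, fun y ↦ by simp [mul_comm]⟩

theorem MeasureTheory.MemLp.integrable_mul_schwartz {p : ℝ≥0∞} [Fact (1 ≤ p)] {f : ℝ → ℂ}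
    (hf : MemLp f p) (ψ : 𝓢(ℝ, ℂ)) : Integrable fun y ↦ f y * ψ y :=
  have := ENNReal.HolderConjugate.conjExponent (Fact.out : 1 ≤ p)
  hf.integrable_mul (ψ.memLp p.conjExponent)

theorem SchwartzMap.exists_norm_le (ψ : 𝓢(ℝ, ℂ)) : ∃ M, 0 < M ∧ ∀ y, ‖ψ y‖ ≤ M := by
  obtain ⟨M, hM, h⟩ := ψ.decay 0 0
  exact ⟨M, hM, fun y ↦ by simpa using h y⟩

/-- A continuous `L^p` function whose regularisations by dilates of a Schwartz function are
band-limited is reproduced by convolution with a Schwartz function. -/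
theorem exists_schwartz_reproducing {p : ℝ≥0∞} [Fact (1 ≤ p)] {f : ℝ → ℂ} (hfc : Continuous f)
    (hf : MemLp f p) {η : 𝓢(ℝ, ℂ)} (hη : η 0 = 1) {R : ℝ} (hR : 0 < R)
    (hband : ∀ c, 0 < c → c ≤ 1 → ∀ w, R < |w| → 𝓕 (fun y ↦ f y * η (c * y)) w = 0) :
    ∃ Φ : 𝓢(ℝ, ℂ), ∀ x, f x = ∫ y, f y * Φ (y - x) := by
  -- As χ = 1 on the band, multiplying a spectrum by χ changes nothing; the kernel is the transform
  -- of χ.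
  let χ : ContDiffBump (0 : ℝ) := ⟨R, R + 1, hR, by linarith⟩
  have hχc : HasCompactSupport (fun ξ ↦ (χ ξ : ℂ)) :=
    χ.hasCompactSupport.comp_left (g := fun t : ℝ ↦ (t : ℂ)) (by simp)
  have hχs : ContDiff ℝ ∞ (fun ξ ↦ (χ ξ : ℂ)) := Complex.ofRealCLM.contDiff.comp χ.contDiff
  refine ⟨𝓕 (hχc.toSchwartzMap hχs), fun x ↦ ?_⟩
  set Φ : 𝓢(ℝ, ℂ) := 𝓕 (hχc.toSchwartzMap hχs) with hΦ
  have hΦint : Integrable fun y ↦ f y * Φ (y - x) := by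
    simpa using hf.integrable_mul_schwartz (Φ.compSubConstCLM ℂ x)
  let e : ℝ → ℂ := fun ξ ↦ Complex.exp (2 * Real.pi * Complex.I * x * ξ) * (χ ξ : ℂ)
  have he : Integrable e := by
    refine Continuous.integrable_of_hasCompactSupport ?_ hχc.mul_left
    have := χ.continuous
    fun_prop
  have hFe : ∀ y, 𝓕 e y = Φ (y - x) := by
    intro y
    rw [hΦ, SchwartzMap.fourier_coe, Real.fourier_real_eq_integral_exp_smul,
      Real.fourier_real_eq_integral_exp_smul]
    congr 1
    ext ξ
    simp only [e, HasCompactSupport.coe_toSchwartzMap, smul_eq_mul]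
    rw [← mul_assoc, ← Complex.exp_add]
    push_cast
    ring_nf
  -- Fourier inversion at `x`, with χ inserted, followed by the multiplication formula ∫ ĝ e = ∫ g
  -- ê.
  have key : ∀ c, 0 < c → c ≤ 1 → f x * η (c * x) = ∫ y, f y * η (c * y) * Φ (y - x) := by
    intro c hc hc1
    obtain ⟨ψ, hψ⟩ := η.exists_eq_comp_mul hc.ne'
    have hg : Integrable fun y ↦ f y * η (c * y) := by
      simpa only [hψ] using hf.integrable_mul_schwartz ψ
    have hgc : Continuous fun y ↦ f y * η (c * y) := by
      have := η.continuous
      fun_prop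
    have h1 := VectorFourier.integral_fourierIntegral_smul_eq_flip (L := innerₗ ℝ)
      Real.continuous_fourierChar (by exact continuous_inner) hg he
    have h2 := hg.fourierInv_fourier_eq (hg.integrable_fourier_of_eq_zero (hband c hc hc1))
      (hgc.continuousAt (x := x))
    rw [← h2, Real.fourierInv_eq']
    have h3 : ∫ y, f y * η (c * y) * Φ (y - x) = ∫ y, (f y * η (c * y)) • 𝓕 e y := by
      simp only [hFe, smul_eq_mul]
    rw [h3]
    have h4 : (innerₗ ℝ).flip = innerₗ ℝ := flip_innerₗ ℝ
    rw [h4] at h1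
    refine Eq.trans ?_ h1
    congr 1
    ext ξ
    change _ = 𝓕 (fun y ↦ f y * η (c * y)) ξ • e ξ
    simp only [e, smul_eq_mul, RCLike.inner_apply, conj_trivial]
    rcases le_or_gt |ξ| R with h | h
    · rw [χ.one_of_mem_closedBall (by simpa using h)]
      push_cast
      ring_nf
    · rw [hband c hc hc1 ξ h]
      simp
  have hc0 : Tendsto (fun n : ℕ ↦ 1 / ((n : ℝ) + 1)) atTop (𝓝 0) :=
    tendsto_one_div_add_atTop_nhds_zero_nat
  have hηt : ∀ y, Tendsto (fun n : ℕ ↦ η (1 / ((n : ℝ) + 1) * y)) atTop (𝓝 1) := by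
    intro y
    rw [← hη]
    refine (η.continuous.tendsto 0).comp ?_
    simpa using hc0.mul_const y
  have hl : Tendsto (fun n : ℕ ↦ f x * η (1 / ((n : ℝ) + 1) * x)) atTop (𝓝 (f x)) := by
    simpa using (hηt x).const_mul (f x)
  obtain ⟨M, hM, hMb⟩ := η.exists_norm_le
  have hr : Tendsto (fun n : ℕ ↦ ∫ y, f y * η (1 / ((n : ℝ) + 1) * y) * Φ (y - x)) atTop
      (𝓝 (∫ y, f y * Φ (y - x))) := by
    refine tendsto_integral_of_dominated_convergence (fun y ↦ M * ‖f y * Φ (y - x)‖)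
      (fun n ↦ ?_) (hΦint.norm.const_mul M) (fun n ↦ ae_of_all _ fun y ↦ ?_)
      (ae_of_all _ fun y ↦ ?_)
    · have h1 := η.continuous
      have h2 := Φ.continuous
      exact Continuous.aestronglyMeasurable (by fun_prop)
    · rw [norm_mul, norm_mul, norm_mul, mul_comm ‖f y‖, mul_assoc]
      gcongr
      exact hMb _
    · simpa using ((hηt y).const_mul (f y)).mul_const (Φ (y - x))
  refine tendsto_nhds_unique hl (hr.congr fun n ↦ (key _ ?_ ?_).symm)
  · positivity
  · rw [div_le_one (by positivity)]
    linarith [n.cast_nonneg (α := ℝ)]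

/-- Quadratic decay suffices. The bound is uniform over steps h ≥ h₀ because the sampling step will
vary along the approximation. -/
theorem SchwartzMap.exists_tsum_norm_translate_le (Φ : 𝓢(ℝ, ℂ)) {h₀ : ℝ} (h₀pos : 0 < h₀) :
    ∃ D, ∀ h, h₀ ≤ h → ∀ y : ℝ, Summable (fun k : ℤ ↦ ‖Φ (y - k * h)‖) ∧
      ∑' k : ℤ, ‖Φ (y - k * h)‖ ≤ D := by
  obtain ⟨C, hC⟩ := Real.exists_tsum_one_add_abs_sub_rpow_le one_lt_two
  obtain ⟨A, hA⟩ : ∃ A, ∀ u : ℝ, (1 + ‖u‖) ^ 2 * ‖iteratedFDeriv ℝ 0 Φ u‖ ≤ A :=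
    ⟨_, fun u ↦ SchwartzMap.one_add_le_sup_seminorm_apply (𝕜 := ℝ) (m := (2, 0)) le_rfl le_rfl Φ u⟩
  have hA0 : 0 ≤ A := (by positivity : (0 : ℝ) ≤ _).trans (hA 0)
  set m := min 1 h₀
  have hm : 0 < m := lt_min one_pos h₀pos
  refine ⟨A / m ^ 2 * C, fun h hh y ↦ ?_⟩
  have hh0 : 0 < h := h₀pos.trans_le hh
  obtain ⟨h1, h2⟩ := hC (y / h)
  have hle : ∀ k : ℤ, ‖Φ (y - k * h)‖ ≤ A / m ^ 2 * (1 + |y / h - k|) ^ (-2 : ℝ) := by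
    intro k
    have h3 := hA (y - k * h)
    rw [norm_iteratedFDeriv_zero, Real.norm_eq_abs] at h3
    have h4 : m * (1 + |y / h - k|) ≤ 1 + |y - k * h| := by
      have : |y - k * h| = h * |y / h - k| := by
        rw [← abs_of_pos hh0, ← abs_mul, abs_of_pos hh0]
        congr 1
        field_simp
      rw [this, mul_add, mul_one]
      have h5 : m ≤ h := (min_le_right _ _).trans hh
      gcongr
      exact min_le_left _ _
    rw [Real.rpow_neg (by positivity), ← div_eq_mul_inv, div_div, Real.rpow_two, ← mul_pow,
      le_div_iff₀ (by positivity), mul_comm]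
    refine le_trans ?_ h3
    gcongr
  have hS := h1.mul_left (A / m ^ 2)
  have hS' : Summable (fun k : ℤ ↦ ‖Φ (y - k * h)‖) :=
    Summable.of_nonneg_of_le (fun k ↦ norm_nonneg _) hle hS
  refine ⟨hS', (hS'.tsum_le_tsum hle hS).trans ?_⟩
  rw [tsum_mul_left]
  gcongr

/-- The Plancherel–Pólya inequality for a function reproduced by a Schwartz kernel. -/
theorem exists_tsum_norm_rpow_le {r : ℝ} (hr : 1 < r) {f : ℝ → ℂ} (hfc : Continuous f)
    (hf : ∫⁻ y, ‖f y‖ₑ ^ r ≠ ⊤) {Φ : 𝓢(ℝ, ℂ)} (hΦ : ∀ x, f x = ∫ y, f y * Φ (y - x))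
    {h₀ : ℝ} (h₀pos : 0 < h₀) :
    ∃ C, ∀ h, h₀ ≤ h → Summable (fun k : ℤ ↦ ‖f (k * h)‖ ^ r) ∧
      ∑' k : ℤ, ‖f (k * h)‖ ^ r ≤ C := by
  have hr0 : 0 < r := by linarith
  obtain ⟨D, hD⟩ := Φ.exists_tsum_norm_translate_le h₀pos
  have hpq : r.HolderConjugate r.conjExponent := .conjExponent hr
  set q := r.conjExponent
  have hΦm : ∀ x : ℝ, Measurable fun y ↦ ‖Φ (y - x)‖ₑ := fun x ↦
    (Φ.continuous.comp (continuous_id.sub continuous_const)).enorm.measurable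
  have hfm : Measurable fun y ↦ ‖f y‖ₑ := hfc.enorm.measurable
  set A : ℝ≥0∞ := ∫⁻ y, ‖Φ y‖ₑ
  have hAtop : A ≠ ⊤ := Φ.integrable.2.ne
  -- Hölder after splitting |Φ| = |Φ|^(1/r) |Φ|^(1/q): one full power of Φ stays with |f|^r, ready
  -- to be summed over the lattice.
  have hpt : ∀ x, ‖f x‖ₑ ^ r ≤ A ^ (1 / q * r) * ∫⁻ y, ‖f y‖ₑ ^ r * ‖Φ (y - x)‖ₑ := by
    intro x
    have h1 : ‖f x‖ₑ ≤ ∫⁻ y, (‖f y‖ₑ * ‖Φ (y - x)‖ₑ ^ (1 / r)) * ‖Φ (y - x)‖ₑ ^ (1 / q) := by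
      conv_lhs => rw [hΦ x]
      refine (enorm_integral_le_lintegral_enorm _).trans_eq (lintegral_congr fun y ↦ ?_)
      rw [enorm_mul, mul_assoc, ← ENNReal.rpow_add_of_nonneg _ _ (by have := hpq.pos; positivity)
        (by have := hpq.symm.pos; positivity), one_div, one_div, hpq.inv_add_inv_eq_one,
        ENNReal.rpow_one]
    have h2 := ENNReal.lintegral_mul_le_Lp_mul_Lq volume hpq
      (f := fun y ↦ ‖f y‖ₑ * ‖Φ (y - x)‖ₑ ^ (1 / r)) (g := fun y ↦ ‖Φ (y - x)‖ₑ ^ (1 / q))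
      ((hfm.mul ((hΦm x).pow_const _)).aemeasurable) ((hΦm x).pow_const _).aemeasurable
    have h3 : ∫⁻ y, (‖Φ (y - x)‖ₑ ^ (1 / q)) ^ q = A := by
      simp_rw [← ENNReal.rpow_mul, one_div_mul_cancel hpq.symm.ne_zero, ENNReal.rpow_one]
      exact lintegral_sub_right_eq_self (fun y ↦ ‖Φ y‖ₑ) x
    have h4 : ∀ y, (‖f y‖ₑ * ‖Φ (y - x)‖ₑ ^ (1 / r)) ^ r = ‖f y‖ₑ ^ r * ‖Φ (y - x)‖ₑ := by
      intro y
      rw [ENNReal.mul_rpow_of_nonneg _ _ hr0.le, ← ENNReal.rpow_mul,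
        one_div_mul_cancel hr0.ne', ENNReal.rpow_one]
    have h5 := h1.trans h2
    rw [h3] at h5
    simp_rw [h4] at h5
    refine (ENNReal.rpow_le_rpow h5 hr0.le).trans_eq ?_
    rw [ENNReal.mul_rpow_of_nonneg _ _ hr0.le, ← ENNReal.rpow_mul, ← ENNReal.rpow_mul,
      one_div_mul_cancel hr0.ne', ENNReal.rpow_one, mul_comm]
  set K : ℝ≥0∞ := A ^ (1 / q * r) * ((∫⁻ y, ‖f y‖ₑ ^ r) * ENNReal.ofReal D) with hK
  have hKtop : K ≠ ⊤ := by
    refine ENNReal.mul_ne_top (ENNReal.rpow_ne_top_of_nonneg ?_ hAtop)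
      (ENNReal.mul_ne_top hf ENNReal.ofReal_ne_top)
    have := hpq.symm.pos
    positivity
  have hsum : ∀ h, h₀ ≤ h → ∑' k : ℤ, ‖f (k * h)‖ₑ ^ r ≤ K := by
    intro h hh
    calc ∑' k : ℤ, ‖f (k * h)‖ₑ ^ r
        ≤ ∑' k : ℤ, A ^ (1 / q * r) * ∫⁻ y, ‖f y‖ₑ ^ r * ‖Φ (y - k * h)‖ₑ :=
          ENNReal.tsum_le_tsum fun k ↦ hpt _
      _ = A ^ (1 / q * r) * ∫⁻ y, ‖f y‖ₑ ^ r * ∑' k : ℤ, ‖Φ (y - k * h)‖ₑ := by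
          have hm : ∀ k : ℤ, AEMeasurable fun y ↦ ‖f y‖ₑ ^ r * ‖Φ (y - k * h)‖ₑ := fun k ↦
            ((hfm.pow_const _).mul (hΦm _)).aemeasurable
          rw [ENNReal.tsum_mul_left, ← lintegral_tsum hm]
          simp_rw [ENNReal.tsum_mul_left]
      _ ≤ A ^ (1 / q * r) * ∫⁻ y, ‖f y‖ₑ ^ r * ENNReal.ofReal D := by
          gcongr with y
          simp_rw [← ofReal_norm]
          rw [← ENNReal.ofReal_tsum_of_nonneg (fun _ ↦ norm_nonneg _) (hD h hh y).1]
          exact ENNReal.ofReal_le_ofReal (hD h hh y).2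
      _ = K := by rw [lintegral_mul_const _ (hfm.pow_const _)]
  refine ⟨K.toReal, fun h hh ↦ ?_⟩
  have hfin : ∀ s : Finset ℤ, ∑ k ∈ s, ‖f (k * h)‖ ^ r ≤ K.toReal := by
    intro s
    rw [← ENNReal.ofReal_le_iff_le_toReal hKtop,
      ENNReal.ofReal_sum_of_nonneg fun k _ ↦ by positivity]
    refine le_trans ?_ ((ENNReal.sum_le_tsum s).trans (hsum h hh))
    refine Finset.sum_le_sum fun k _ ↦ ?_
    rw [← ENNReal.ofReal_rpow_of_nonneg (norm_nonneg _) hr0.le, ofReal_norm]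
  have hS := summable_of_sum_le (fun k : ℤ ↦ by positivity) hfin
  exact ⟨hS, hS.tsum_le_of_sum_le hfin⟩

/-- Hölder and translation invariance of the kernel's norm. Boundedness allows the exponent of `f`
to be raised. -/
theorem exists_norm_le_of_reproducing {p : ℝ≥0∞} [Fact (1 ≤ p)] {f : ℝ → ℂ}
    (hf : MemLp f p) {Φ : 𝓢(ℝ, ℂ)} (hΦ : ∀ x, f x = ∫ y, f y * Φ (y - x)) :
    ∃ M, 0 < M ∧ ∀ x, ‖f x‖ ≤ M := by
  have := ENNReal.HolderConjugate.conjExponent (Fact.out : 1 ≤ p)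
  set q := p.conjExponent
  have hΦq := Φ.memLp q
  set K := eLpNorm f p volume * eLpNorm Φ q volume
  have hK : K ≠ ⊤ := ENNReal.mul_ne_top hf.2.ne hΦq.2.ne
  refine ⟨K.toReal + 1, by positivity, fun x ↦ ?_⟩
  have h1 : ‖f x‖ₑ ≤ K := by
    conv_lhs => rw [hΦ x]
    refine (enorm_integral_le_lintegral_enorm _).trans ?_
    rw [← eLpNorm_one_eq_lintegral_enorm]
    have hmp : MeasurePreserving (fun y : ℝ ↦ y - x) volume volume :=
      measurePreserving_sub_right volume x
    have h2 : eLpNorm (fun y ↦ Φ (y - x)) q volume = eLpNorm Φ q volume :=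
      eLpNorm_comp_measurePreserving hΦq.1 hmp
    have h3 := eLpNorm_smul_le_mul_eLpNorm (p := p) (q := q) (r := 1) (μ := volume)
      (hΦq.1.comp_measurePreserving hmp) hf.1
    exact h3.trans_eq (congrArg (eLpNorm f p volume * ·) h2)
  have h4 : ‖f x‖ ≤ K.toReal := by
    rw [← ENNReal.ofReal_le_iff_le_toReal hK, ofReal_norm]
    exact h1
  linarith

/-! ### Derivatives of the shifted sinc functions -/

theorem iteratedDeriv_normSinc_comp {σ : ℝ} (m : ℕ) (k x : ℝ) :
    iteratedDeriv m (fun y : ℝ ↦ normSinc (σ * y / Real.pi - k)) x =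
      σ ^ m * iteratedDeriv m Real.sinc (σ * x - Real.pi * k) := by
  have h1 : (fun y : ℝ ↦ normSinc (σ * y / Real.pi - k)) =
      fun y ↦ (fun z ↦ Real.sinc (z - Real.pi * k)) (σ * y) := by
    ext y
    have := Real.pi_pos
    simp only [normSinc]
    congr 1
    field_simp
  have h2 : ContDiff ℝ m fun z ↦ Real.sinc (z - Real.pi * k) :=
    (Real.contDiff_sinc.of_le (mod_cast le_top)).comp (by fun_prop)
  rw [h1, iteratedDeriv_comp_const_mul h2, iteratedDeriv_comp_sub_const]

theorem exists_tsum_norm_iteratedDeriv_normSinc_rpow_le {σ q : ℝ} (hσ : 0 < σ) (hq : 1 < q)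
    (m : ℕ) :
    ∃ C, ∀ x : ℝ, Summable (fun k : ℤ ↦
        ‖((iteratedDeriv m (fun y : ℝ ↦ normSinc (σ * y / Real.pi - k)) x : ℝ) : ℂ)‖ ^ q) ∧
      ∑' k : ℤ, ‖((iteratedDeriv m (fun y : ℝ ↦ normSinc (σ * y / Real.pi - k)) x : ℝ) : ℂ)‖ ^ q
        ≤ C := by
  obtain ⟨C, hC⟩ := Real.exists_tsum_one_add_abs_sub_rpow_le hq
  obtain ⟨A, hA0, hA⟩ := Real.exists_abs_iteratedDeriv_sinc_le m
  refine ⟨(σ ^ m * A) ^ q * C, fun x ↦ ?_⟩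
  obtain ⟨h1, h2⟩ := hC (σ * x / Real.pi)
  have hle : ∀ k : ℤ,
      ‖((iteratedDeriv m (fun y : ℝ ↦ normSinc (σ * y / Real.pi - k)) x : ℝ) : ℂ)‖ ^ q ≤
        (σ ^ m * A) ^ q * (1 + |σ * x / Real.pi - k|) ^ (-q) := by
    intro k
    rw [Real.rpow_neg (by positivity), ← div_eq_mul_inv,
      ← Real.div_rpow (by positivity) (by positivity)]
    refine Real.rpow_le_rpow (norm_nonneg _) ?_ (by linarith)
    rw [Complex.norm_real, Real.norm_eq_abs, iteratedDeriv_normSinc_comp, abs_mul,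
      abs_of_pos (pow_pos hσ m), mul_div_assoc]
    gcongr
    refine (hA _).trans (div_le_div_of_nonneg_left hA0 (by positivity) ?_)
    have h3 : σ * x - Real.pi * k = Real.pi * (σ * x / Real.pi - k) := by
      have := Real.pi_pos
      field_simp
    rw [h3, abs_mul, abs_of_pos Real.pi_pos]
    linarith [le_mul_of_one_le_left (abs_nonneg (σ * x / Real.pi - k))
      (by linarith [Real.pi_gt_three] : 1 ≤ Real.pi)]
  have hS := h1.mul_left ((σ ^ m * A) ^ q)
  have hS' := Summable.of_nonneg_of_le (fun k ↦ by positivity) hle hS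
  refine ⟨hS', (hS'.tsum_le_tsum hle hS).trans ?_⟩
  rw [tsum_mul_left]
  gcongr

theorem hasDerivAt_iteratedDeriv_normSinc (σ k : ℝ) (m : ℕ) (x : ℝ) :
    HasDerivAt (fun x ↦ iteratedDeriv m (fun y : ℝ ↦ normSinc (σ * y / Real.pi - k)) x)
      (iteratedDeriv (m + 1) (fun y : ℝ ↦ normSinc (σ * y / Real.pi - k)) x) x := by
  have h1 : ContDiff ℝ ∞ (fun y : ℝ ↦ normSinc (σ * y / Real.pi - k)) :=
    Real.contDiff_sinc.comp (by fun_prop)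
  rw [iteratedDeriv_succ]
  exact ((h1.differentiable_iteratedDeriv m (mod_cast ENat.natCast_lt_top m)) x).hasDerivAt

/-! ### The cardinal series by regularisation -/

theorem exists_schwartz_fourier_bump {δ : ℝ} (hδ : 0 < δ) :
    ∃ (η : 𝓢(ℝ, ℂ)) (B : ℝ → ℂ), η 0 = 1 ∧ ContDiff ℝ ∞ B ∧ Function.support B ⊆ Icc (-δ) δ ∧
      ∀ y, η y = 𝓕 B y := by
  let φ : ContDiffBump (0 : ℝ) := ⟨δ / 2, δ, by linarith, by linarith⟩
  have hs : ContDiff ℝ ∞ (fun ξ ↦ (φ.normed volume ξ : ℂ)) :=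
    Complex.ofRealCLM.contDiff.comp φ.contDiff_normed
  have hc : HasCompactSupport (fun ξ ↦ (φ.normed volume ξ : ℂ)) :=
    φ.hasCompactSupport_normed.comp_left (g := fun t : ℝ ↦ (t : ℂ)) (by simp)
  refine ⟨𝓕 (hc.toSchwartzMap hs), fun ξ ↦ (φ.normed volume ξ : ℂ), ?_, hs, ?_, fun y ↦ ?_⟩
  · rw [SchwartzMap.fourier_coe, Real.fourier_real_eq_integral_exp_smul]
    simp only [HasCompactSupport.coe_toSchwartzMap, mul_zero, Complex.ofReal_zero, zero_mul,
      Complex.exp_zero, one_smul]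
    rw [integral_complex_ofReal, φ.integral_normed, Complex.ofReal_one]
  · intro ξ hξ
    have h1 : ξ ∈ Function.support (φ.normed volume) := fun h ↦ hξ (by simp [h])
    rw [φ.support_normed_eq, Metric.mem_ball, dist_zero_right, Real.norm_eq_abs] at h1
    exact abs_le.1 h1.le
  · rw [SchwartzMap.fourier_coe, HasCompactSupport.coe_toSchwartzMap]

/-- The samples of a function of the Bernstein space are `r`-summable for some `r > 1`, and the
cardinal series represents the function. -/
theorem IsBernstein.exists_summable_and_hasSum {σ : ℝ} (hσ : 0 < σ) {p : ℝ≥0∞} [Fact (1 ≤ p)]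
    (hp : p ≠ ⊤) {f : ℝ → ℂ} (hf : IsBernstein σ p f) :
    ∃ r : ℝ, 1 < r ∧ Summable (fun k : ℤ ↦ ‖f (k * Real.pi / σ)‖ ^ r) ∧
      ∀ x, HasSum (fun k : ℤ ↦ f (k * Real.pi / σ) *
        ((normSinc (σ * x / Real.pi - k) : ℝ) : ℂ)) (f x) := by
  have hpi := Real.pi_pos
  have hfc : Continuous f := hf.contDiff.continuous
  set T := σ / Real.pi with hT
  have hT0 : 0 < T := by positivity
  have hkT : ∀ k : ℤ, (k : ℝ) * Real.pi / σ = k / T := fun k ↦ by rw [hT]; field_simp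
  have hσT : σ / (2 * Real.pi) = T / 2 := by rw [hT]; field_simp
  obtain ⟨η, B, hη0, hBs, hBsupp, hηB⟩ := exists_schwartz_fourier_bump (δ := T / 8) (by positivity)
  have hband : ∀ c, 0 < c → ∀ w, T / 2 + c * (T / 8) < |w| →
      𝓕 (fun y ↦ f y * η (c * y)) w = 0 := by
    intro c hc w hw
    simp_rw [hηB]
    exact hf.fourier_mul_eq_zero hBs hBsupp hc (by rwa [hσT])
  obtain ⟨Φ, hΦ⟩ := exists_schwartz_reproducing hfc hf.memLp hη0 (R := T) hT0
    fun c hc hc1 w hw ↦ hband c hc w (by nlinarith)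
  obtain ⟨M, hM0, hM⟩ := exists_norm_le_of_reproducing hf.memLp hΦ
  have hp1 : 1 ≤ p := Fact.out
  have hp0 : p ≠ 0 := (zero_lt_one.trans_le hp1).ne'
  have hP : 1 ≤ p.toReal := by
    rw [← ENNReal.toReal_one]
    exact ENNReal.toReal_mono hp hp1
  -- At p = 1 the dual exponent would be infinite; p + 1 keeps it finite, and |f|^(p+1) ≤ M |f|^p.
  set r := p.toReal + 1 with hr
  have hr1 : 1 < r := by linarith
  have hfr : ∫⁻ y, ‖f y‖ₑ ^ r ≠ ⊤ := by
    have h1 := lintegral_rpow_enorm_lt_top_of_eLpNorm_lt_top hp0 hp hf.memLp.2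
    refine ne_top_of_le_ne_top (ENNReal.mul_ne_top h1.ne (ENNReal.ofReal_ne_top (r := M))) ?_
    rw [← lintegral_mul_const' _ _ ENNReal.ofReal_ne_top]
    refine lintegral_mono fun y ↦ ?_
    rw [hr, ENNReal.rpow_add_of_nonneg _ _ (by linarith) zero_le_one, ENNReal.rpow_one]
    gcongr
    rw [← ofReal_norm]
    exact ENNReal.ofReal_le_ofReal (hM y)
  obtain ⟨C, hC⟩ := exists_tsum_norm_rpow_le hr1 hfc hfr hΦ (h₀ := 1 / (2 * T)) (by positivity)
  have ha : Summable (fun k : ℤ ↦ ‖f (k * Real.pi / σ)‖ ^ r) := by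
    have h1 := (hC (1 / T) (one_div_le_one_div_of_le hT0 (by linarith))).1
    simpa only [hkT, mul_one_div] using h1
  refine ⟨r, hr1, ha, fun x ↦ ?_⟩
  have hrq : r.HolderConjugate r.conjExponent := .conjExponent hr1
  set q := r.conjExponent
  obtain ⟨D, hD⟩ := exists_tsum_norm_iteratedDeriv_normSinc_rpow_le hσ hrq.symm.lt 0
  simp only [iteratedDeriv_zero] at hD
  set s : ℤ → ℂ := fun k ↦ ((normSinc (σ * x / Real.pi - k) : ℝ) : ℂ)
  let c : ℕ → ℝ := fun n ↦ 1 / ((n : ℝ) + 1)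
  have hc0 : ∀ n, 0 < c n := fun n ↦ by positivity
  have hc1 : ∀ n, c n ≤ 1 := fun n ↦ by
    simp only [c]
    rw [div_le_one (by positivity)]
    linarith [n.cast_nonneg (α := ℝ)]
  have hclim : Tendsto c atTop (𝓝 0) := tendsto_one_div_add_atTop_nhds_zero_nat
  -- Half of this rate is T/2 + cT/4, strictly beyond the band edge T/2 + cT/8; also S ≤ 2T, so the
  -- step 1/S stays above `h₀`.
  let S : ℕ → ℝ := fun n ↦ T + c n * (T / 2)
  have hS0 : ∀ n, 0 < S n := fun n ↦ by have := hc0 n; positivity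
  have hSlim : Tendsto S atTop (𝓝 T) := by
    simpa using (hclim.mul_const (T / 2)).const_add T
  let g : ℕ → ℝ → ℂ := fun n y ↦ f y * η (c n * y)
  obtain ⟨N, hN0, hN⟩ := η.exists_norm_le
  have hglim : ∀ (y : ℝ), Tendsto (fun n ↦ g n (y / S n)) atTop (𝓝 (f (y / T))) := by
    intro y
    have h1 : Tendsto (fun n ↦ y / S n) atTop (𝓝 (y / T)) := tendsto_const_nhds.div hSlim hT0.ne'
    have h2 : Tendsto (fun n ↦ η (c n * (y / S n))) atTop (𝓝 1) := by
      rw [← hη0]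
      refine (η.continuous.tendsto 0).comp ?_
      simpa using hclim.mul h1
    simpa using ((hfc.tendsto _).comp h1).mul h2
  have hb : ∀ n, Summable (fun k : ℤ ↦ ‖g n (k / S n)‖ ^ r) ∧
      ∑' k : ℤ, ‖g n (k / S n)‖ ^ r ≤ N ^ r * C := by
    intro n
    have hle : 1 / (2 * T) ≤ 1 / S n := by
      refine one_div_le_one_div_of_le (hS0 n) ?_
      have := hc1 n
      simp only [S]
      nlinarith
    obtain ⟨h1, h2⟩ := hC (1 / S n) hle
    simp only [mul_one_div] at h1 h2
    have h3 : ∀ k : ℤ, ‖g n (k / S n)‖ ^ r ≤ N ^ r * ‖f (k / S n)‖ ^ r := by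
      intro k
      rw [← Real.mul_rpow hN0.le (norm_nonneg _), norm_mul, mul_comm]
      refine Real.rpow_le_rpow (by positivity) ?_ (by linarith)
      gcongr
      exact hN _
    have h4 := h1.mul_left (N ^ r)
    have h5 := Summable.of_nonneg_of_le (fun k ↦ by positivity) h3 h4
    refine ⟨h5, (h5.tsum_le_tsum h3 h4).trans ?_⟩
    rw [tsum_mul_left]
    gcongr
  -- The sinc values form the fixed sequence here, and the samples of the `g n` the bounded family.
  obtain ⟨-, hunif⟩ := tendstoUniformly_sum_mul_of_rpow hrq.symm (hD x).1
    (fun n ↦ (hb n).1) (fun n ↦ (hb n).2)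
  -- Evaluating at the moving point (σx/π)/S n keeps the arguments of `sinc`, hence `s`, independent
  -- of `n`.
  have hsamp : ∀ n, ∑' k : ℤ, s k * g n (k / S n) = g n (σ * x / Real.pi / S n) := by
    intro n
    obtain ⟨ψ, hψ⟩ := η.exists_eq_comp_mul (hc0 n).ne'
    have hgi : Integrable (g n) := by
      simpa only [hψ] using hf.memLp.integrable_mul_schwartz ψ
    have hgc : Continuous (g n) := by
      have := η.continuous
      fun_prop
    have hgs : Summable fun k : ℤ ↦ ‖g n (k / S n)‖ := by
      obtain ⟨E, hE⟩ := ψ.exists_tsum_norm_translate_le (h₀ := 1 / S n) (by have := hS0 n; positivity)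
      have h1 := ((Equiv.neg ℤ).summable_iff.2 (hE _ le_rfl 0).1).mul_left M
      refine Summable.of_nonneg_of_le (fun k ↦ norm_nonneg _) (fun k ↦ ?_) h1
      simp only [Function.comp_apply, Equiv.neg_apply, Int.cast_neg, mul_one_div, zero_sub, neg_div,
        neg_neg, hψ, g, norm_mul]
      gcongr
      exact hM _
    have h1 := hasSum_sinc_of_fourier_eq_zero (hS0 n) hgc hgi (fun ξ hξ ↦ hband _ (hc0 n) ξ (by
      have := mul_pos (hc0 n) hT0
      simp only [S] at hξ
      linarith)) hgs (σ * x / Real.pi / S n)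
    rw [mul_div_cancel₀ _ (hS0 n).ne'] at h1
    rw [← h1.tsum_eq]
    exact tsum_congr fun k ↦ mul_comm _ _
  have hsum : Summable fun k : ℤ ↦ s k * f (k * Real.pi / σ) :=
    ((tendstoUniformly_sum_mul_of_rpow (ι := Unit) hrq.symm (hD x).1 (fun _ ↦ ha)
      (fun _ ↦ le_rfl)).1 ()).of_norm
  have hlim : Tendsto (fun n ↦ ∑' k : ℤ, s k * g n (k / S n)) atTop
      (𝓝 (∑' k : ℤ, s k * f (k * Real.pi / σ))) := by
    rw [← tendstoUniformlyOn_univ] at hunif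
    refine (hunif.tendstoUniformlyOnFilter.mono_right
      (by simp : (atTop : Filter ℕ) ≤ 𝓟 univ)).tendsto_of_eventually_tendsto
      (Eventually.of_forall fun F ↦ ?_) hsum.hasSum
    refine tendsto_finsetSum _ fun k _ ↦ ?_
    rw [hkT]
    exact (hglim k).const_mul _
  simp_rw [hsamp] at hlim
  have hfx := tendsto_nhds_unique hlim (hglim (σ * x / Real.pi))
  have hxT : σ * x / Real.pi / T = x := by rw [hT]; field_simp
  rw [hxT] at hfx
  rw [← hfx]
  simpa only [mul_comm (s _)] using hsum.hasSum

/-! ### Termwise differentiation -/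

theorem mainTheorem9 (σ : ℝ) (hσ : 0 < σ) (p : ℝ≥0∞) [Fact (1 ≤ p)] (hp : p ≠ ⊤)
    (f : ℝ → ℂ) (hf : f ∈ bernsteinSpace σ p) :
    SumsAbsolutelyUniformly
      (fun k x ↦ f (k * Real.pi / σ) * ((normSinc (σ * x / Real.pi - k) : ℝ) : ℂ)) f ∧
    ∀ m : ℕ, SumsAbsolutelyUniformly
      (fun k x ↦ f (k * Real.pi / σ) *
        ((iteratedDeriv m (fun y : ℝ ↦ normSinc (σ * y / Real.pi - k)) x : ℝ) : ℂ))
      (iteratedDeriv m f) := by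
  obtain ⟨r, hr, ha, hf0⟩ := IsBernstein.exists_summable_and_hasSum hσ hp hf
  have hrq : r.HolderConjugate r.conjExponent := .conjExponent hr
  have hU : ∀ m : ℕ, _ := fun m ↦
    have ⟨_, hD⟩ := exists_tsum_norm_iteratedDeriv_normSinc_rpow_le hσ hrq.symm.lt m
    tendstoUniformly_sum_mul_of_rpow hrq ha (fun x ↦ (hD x).1) (fun x ↦ (hD x).2)
  have hval : ∀ m : ℕ, iteratedDeriv m f = fun x ↦ ∑' k : ℤ, f (k * Real.pi / σ) *
      ((iteratedDeriv m (fun y : ℝ ↦ normSinc (σ * y / Real.pi - k)) x : ℝ) : ℂ) := by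
    intro m
    induction m with
    | zero =>
      ext x
      simpa only [iteratedDeriv_zero] using (hf0 x).tsum_eq.symm
    | succ m ih =>
      ext x
      rw [iteratedDeriv_succ, ih]
      -- Uniform convergence of the derived series and pointwise convergence of the series itself
      -- justify differentiating under the sum.
      refine (hasDerivAt_of_tendstoUniformly (hU (m + 1)).2 (Eventually.of_forall fun F y ↦ ?_)
        (fun y ↦ ((hU m).1 y).of_norm.hasSum) x).deriv
      exact HasDerivAt.fun_sum fun k _ ↦
        (hasDerivAt_iteratedDeriv_normSinc σ k m y).ofReal_comp.const_mul _
  have hmain : ∀ m : ℕ, SumsAbsolutelyUniformly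
      (fun k x ↦ f (k * Real.pi / σ) *
        ((iteratedDeriv m (fun y : ℝ ↦ normSinc (σ * y / Real.pi - k)) x : ℝ) : ℂ))
      (iteratedDeriv m f) := by
    intro m
    rw [hval m]
    exact ⟨fun x ↦ ((hU m).1 x).of_norm.hasSum, (hU m).1, (hU m).2⟩
  refine ⟨?_, hmain⟩
  simpa only [iteratedDeriv_zero] using hmain 0
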